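/- Let $E$ be an arbitrary subset of $\mathbb{R}^n$, and let $f : E \to \mathbb{R}^n$ be a continuous map that is zero-free on the interior $E^\circ$ of $E$ in $\mathbb{R}^n$ (that is, $f(x) \neq 0$ for every $x \in E^\circ$). Then $f$ is a uniform limit of continuous $\mathbb{R}^n$-valued maps that are zero-free on all of $E$: there is a sequence of continuous maps $g_k : E \to \mathbb{R}^n$, $k = 0, 1, 2, \dots$, with $g_k(x) \neq 0$ for all $x \in E$ and all $k$, that converges to $f$ uniformly on $E$. -/

import Mathlib

open Filter Topology Metric

/-! The zeros of an approximation are driven to points outside `E`. Extend `f`, up to `ε`, to `F` on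
an open `V ⊇ E`. The small values of `F` off `interior E` occur in the closure of `Eᶜ`, so locally
finite balls centred in a countable dense `D ⊆ Eᶜ` cover them, with `F` still small on the balls. As
`f` is zero-free on `interior E`, some smooth map near `F` vanishes only in the balls. Smooth maps
between spaces of equal dimension keep null sets null, so a small perturbation `G` is also nonzero
on the spheres (`exists_perturbation_ne_zero_on_null`). Pushing each ball radially onto its sphere
before applying `G` fails only at the centres, outside `E`, and changes little because `G` is small
on the balls (`exists_zeroFree_off_centers`). -/

/-- The map pushing points of `ball q r` radially away from `q` onto the sphere, fixing all points
outside the ball. -/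
noncomputable def radialPush {H : Type*} [NormedAddCommGroup H] [NormedSpace ℝ H]
    (q : H) (r : ℝ) (x : H) : H :=
  q + max 1 (r / ‖x - q‖) • (x - q)

/-! ### Removing zeros by radial pushes -/

section RadialPush

variable {H : Type*} [NormedAddCommGroup H] [NormedSpace ℝ H]

theorem radialPush_of_notMem {q : H} {r : ℝ} {x : H} (hx : x ∉ closedBall q r) :
    radialPush q r x = x := by
  rw [mem_closedBall, dist_eq_norm, not_le] at hx
  have h : r / ‖x - q‖ ≤ 1 := div_le_one_of_le₀ hx.le (norm_nonneg _)
  simp [radialPush, max_eq_left h]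

theorem radialPush_of_nonpos {q : H} {r : ℝ} (hr : r ≤ 0) (x : H) : radialPush q r x = x := by
  have h : r / ‖x - q‖ ≤ 1 := (div_nonpos_of_nonpos_of_nonneg hr (norm_nonneg _)).trans zero_le_one
  simp [radialPush, max_eq_left h]

theorem radialPush_mem_sphere {q : H} {r : ℝ} {x : H} (hx : x ∈ closedBall q r) (hxq : x ≠ q) :
    radialPush q r x ∈ sphere q r := by
  rw [mem_closedBall, dist_eq_norm] at hx
  have h0 : 0 < ‖x - q‖ := norm_pos_iff.2 (sub_ne_zero.2 hxq)
  have h : 1 ≤ r / ‖x - q‖ := (one_le_div h0).2 hx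
  rw [mem_sphere, dist_eq_norm, radialPush, max_eq_right h, add_sub_cancel_left, norm_smul,
    Real.norm_of_nonneg (zero_le_one.trans h), div_mul_cancel₀ _ h0.ne']

theorem continuousAt_radialPush {q : H} {r : ℝ} {x : H} (h : 0 < r → x ≠ q) :
    ContinuousAt (radialPush q r) x := by
  by_cases hr : 0 < r
  · have h0 : ‖x - q‖ ≠ 0 := norm_ne_zero_iff.2 (sub_ne_zero.2 (h hr))
    unfold radialPush
    fun_prop (disch := assumption)
  · rw [show radialPush q r = id from funext (radialPush_of_nonpos (not_lt.1 hr))]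
    exact continuousAt_id

/-- Precomposition with the first `k` radial pushes. -/
noncomputable def iteratedPush {F : Type*} (G : H → F) (q : ℕ → H) (r : ℕ → ℝ) : ℕ → H → F
  | 0 => G
  | k + 1 => iteratedPush G q r k ∘ radialPush (q k) (r k)

/-- A map whose zeros are covered by a locally finite family of balls, and that does not vanish on
their boundary spheres, can be made zero-free off the centres by changing it in the balls only. -/
theorem exists_zeroFree_off_centers {F : Type*} [NormedAddCommGroup F] {V : Set H} {G : H → F}
    (hG : ContinuousOn G V) {q : ℕ → H} {r : ℕ → ℝ} {M : ℝ}
    (hV : ∀ k, closedBall (q k) (r k) ⊆ V)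
    (hfin : ∀ x ∈ V, ∃ t ∈ 𝓝 x, {k | (closedBall (q k) (r k) ∩ t).Nonempty}.Finite)
    (hsphere : ∀ k, ∀ y ∈ sphere (q k) (r k), G y ≠ 0)
    (hq : ∀ j k, 0 < r j → q j ∉ sphere (q k) (r k))
    (hM : ∀ k, ∀ y ∈ closedBall (q k) (r k), ‖G y‖ ≤ M)
    (hzero : ∀ x ∈ V, G x = 0 → ∃ k, x ∈ closedBall (q k) (r k)) :
    ∃ g : H → F, ContinuousOn g (V \ {x | ∃ k, 0 < r k ∧ x = q k}) ∧
      ∀ x ∈ V \ {x | ∃ k, 0 < r k ∧ x = q k}, g x ≠ 0 ∧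
        (g x = G x ∨ (∃ k, x ∈ closedBall (q k) (r k)) ∧ ‖g x‖ ≤ M) := by
  set W := V \ {x | ∃ k, 0 < r k ∧ x = q k} with hW
  set P := iteratedPush G q r with hP
  have hsucc (k : ℕ) (x : H) : P (k + 1) x = P k (radialPush (q k) (r k) x) := rfl
  have hne {x : H} (hx : x ∈ W) (k : ℕ) (hk : 0 < r k) : x ≠ q k := fun h ↦ hx.2 ⟨k, hk, h⟩
  have hcases {x : H} (hx : x ∈ W) (k : ℕ) :
      radialPush (q k) (r k) x = x ∨
        x ∈ closedBall (q k) (r k) ∧ radialPush (q k) (r k) x ∈ sphere (q k) (r k) := by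
    by_cases hxk : x ∈ closedBall (q k) (r k)
    · by_cases hr : 0 < r k
      · exact .inr ⟨hxk, radialPush_mem_sphere hxk (hne hx k hr)⟩
      · exact .inl (radialPush_of_nonpos (not_lt.1 hr) x)
    · exact .inl (radialPush_of_notMem hxk)
  have hmaps (k : ℕ) : Set.MapsTo (radialPush (q k) (r k)) W W := by
    intro x hx
    rcases hcases hx k with h | ⟨-, h⟩
    · rwa [h]
    · refine ⟨hV k (sphere_subset_closedBall h), ?_⟩
      rintro ⟨j, hj, hjx⟩
      exact hq j k hj (hjx ▸ h)
  have hcont (k : ℕ) : ContinuousOn (P k) W := by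
    induction k with
    | zero => exact hG.mono Set.sdiff_subset
    | succ k ih =>
      exact ih.comp (fun x hx ↦ (continuousAt_radialPush (hne hx k)).continuousWithinAt) (hmaps k)
  -- A zero in the `k`-th ball would be pushed to a zero of `G` on the sphere, so each push clears
  -- its ball.
  have hz (k : ℕ) : ∀ x ∈ W, P k x = 0 → G x = 0 ∧ ∀ j < k, x ∉ closedBall (q j) (r j) := by
    induction k with
    | zero => exact fun x _ h ↦ ⟨h, fun j hj ↦ absurd hj (Nat.not_lt_zero j)⟩
    | succ k ih =>
      intro x hx h
      rw [hsucc] at h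
      have h' := ih _ (hmaps k hx) h
      by_cases hxk : x ∈ closedBall (q k) (r k)
      · exfalso
        have hxq : x ≠ q k := by
          rintro rfl
          rcases (nonempty_closedBall.1 ⟨_, hxk⟩).lt_or_eq with hr | hr
          · exact hne hx k hr rfl
          · refine hsphere k (q k) (by simp [← hr]) ?_
            rw [radialPush_of_nonpos hr.ge] at h'
            exact h'.1
        exact hsphere k _ (radialPush_mem_sphere hxk hxq) h'.1
      · rw [radialPush_of_notMem hxk] at h'
        refine ⟨h'.1, fun j hj ↦ ?_⟩
        rcases Nat.lt_succ_iff_lt_or_eq.1 hj with hj | rfl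
        exacts [h'.2 j hj, hxk]
  have hb (k : ℕ) : ∀ x ∈ W, P k x = G x ∨ (∃ j, x ∈ closedBall (q j) (r j)) ∧ ‖P k x‖ ≤ M := by
    induction k with
    | zero => exact fun x _ ↦ .inl rfl
    | succ k ih =>
      intro x hx
      rw [hsucc]
      rcases hcases hx k with h | ⟨hxk, h⟩
      · rw [h]
        exact ih x hx
      · refine .inr ⟨⟨k, hxk⟩, ?_⟩
        rcases ih _ (hmaps k hx) with h' | h'
        · rw [h']
          exact hM k _ (sphere_subset_closedBall h)
        · exact h'.2
  -- The newest push acts first, hence on `y` itself, and fixes `y` outside its ball; by local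
  -- finiteness the sequence is locally eventually constant.
  have hev : ∀ x ∈ V, ∃ K, (∀ᶠ y in 𝓝 x, ∀ k ≥ K, P k y = P K y) ∧
      ∀ j ≥ K, x ∉ closedBall (q j) (r j) := by
    intro x hx
    obtain ⟨t, ht, hfin⟩ := hfin x hx
    obtain ⟨K, hK⟩ := hfin.bddAbove
    have hout : ∀ y ∈ t, ∀ j ≥ K + 1, y ∉ closedBall (q j) (r j) := by
      intro y hy j hj hyj
      have := hK (show j ∈ {k | (closedBall (q k) (r k) ∩ t).Nonempty} from ⟨y, hyj, hy⟩)
      omega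
    refine ⟨K + 1, ?_, hout x (mem_of_mem_nhds ht)⟩
    filter_upwards [ht] with y hy k hk
    induction k, hk using Nat.le_induction with
    | base => rfl
    | succ k hk ih => rw [hsucc, radialPush_of_notMem (hout y hy k hk), ih]
  choose! K hK using hev
  have hg : ∀ x ∈ V, (fun y ↦ P (K y) y) =ᶠ[𝓝[V] x] P (K x) := by
    intro x hx
    filter_upwards [mem_nhdsWithin_of_mem_nhds (hK x hx).1, self_mem_nhdsWithin] with y hy hyV
    rw [← hy _ (le_max_left _ (K y))]
    exact ((hK y hyV).1.self_of_nhds _ (le_max_right _ _)).symm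
  refine ⟨fun x ↦ P (K x) x, fun x hx ↦ ?_, fun x hx ↦ ⟨fun h ↦ ?_, hb (K x) x hx⟩⟩
  · exact (hcont (K x) x hx).congr_of_eventuallyEq
      ((hg x hx.1).filter_mono (nhdsWithin_mono x Set.sdiff_subset)) rfl
  · obtain ⟨h0, h1⟩ := hz (K x) x hx h
    obtain ⟨k, hk⟩ := hzero x hx.1 h0
    rcases lt_or_ge k (K x) with h2 | h2
    · exact h1 k h2 hk
    · exact (hK x hx.1).2 k h2 hk

end RadialPush

/-! ### Smooth selections under convex constraints -/

theorem Convex.setOf_imp {F : Type*} [AddCommGroup F] [Module ℝ F] {s : Set F} (hs : Convex ℝ s)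
    (p : Prop) : Convex ℝ {c | p → c ∈ s} := by
  by_cases hp : p
  · simpa only [hp, true_imp_iff, Set.ofPred_mem_eq] using hs
  · simpa only [hp, false_imp_iff, Set.ofPred_true] using convex_univ

section Selection

open scoped Manifold ContDiff

/-- Smooth selection of a convex-valued map on an open set, from locally constant selections. -/
theorem IsOpen.exists_contDiffOn_forall_mem_convex {H F : Type*} [NormedAddCommGroup H]
    [NormedSpace ℝ H] [FiniteDimensional ℝ H] [NormedAddCommGroup F] [NormedSpace ℝ F]
    {V : Set H} (hV : IsOpen V) {t : H → Set F} (ht : ∀ x ∈ V, Convex ℝ (t x))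
    (hloc : ∀ x ∈ V, ∃ c, ∀ᶠ y in 𝓝 x, y ∈ V → c ∈ t y) :
    ∃ G : H → F, ContDiffOn ℝ ∞ G V ∧ ∀ x ∈ V, G x ∈ t x := by
  classical
  let U : TopologicalSpace.Opens H := ⟨V, hV⟩
  have : LocallyCompactSpace U := hV.locallyCompactSpace
  have : SigmaCompactSpace U := sigmaCompactSpace_of_locallyCompact_secondCountable
  obtain ⟨g, hg⟩ := exists_contMDiffMap_forall_mem_convex_of_local_const (n := (⊤ : ℕ∞)) 𝓘(ℝ, H)
    (M := U) (t := fun x ↦ t x) (fun x ↦ ht x x.2) (fun x ↦ by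
      obtain ⟨c, hc⟩ := hloc x x.2
      refine ⟨c, ?_⟩
      filter_upwards [continuous_subtype_val.continuousAt.eventually hc] with y hy
      exact hy y.2)
  let G : H → F := fun x ↦ if h : x ∈ V then g ⟨x, h⟩ else 0
  have hGg (x : U) : G x = g x := dif_pos x.2
  refine ⟨G, fun x hx ↦ ?_, fun x hx ↦ ?_⟩
  · have h : ContMDiffAt 𝓘(ℝ, H) 𝓘(ℝ, F) ∞ (fun y : U ↦ G y) ⟨x, hx⟩ :=
      (g.contMDiff ⟨x, hx⟩).congr_of_eventuallyEq (.of_forall hGg)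
    have h' := (contMDiffAt_subtype_iff (U := U) (f := G)).1 h
    exact h'.contDiffAt.contDiffWithinAt
  · rw [hGg ⟨x, hx⟩]
    exact hg ⟨x, hx⟩

end Selection

/-! ### Locally finite ball covers -/

section BallCover

/-- A locally finite cover by balls centred in a countable set, none of whose boundary spheres
meets the set of centres. Unused indices carry an empty ball of negative radius. -/
theorem exists_locallyFinite_ball_cover {H : Type*} [NormedAddCommGroup H] [NormedSpace ℝ H]
    [FiniteDimensional ℝ H] {V O Y D : Set H} (hV : IsOpen V) (hO : IsOpen O) (hYO : Y ⊆ O)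
    (hYV : IsClosed ((↑) ⁻¹' Y : Set V)) (hY : Y ⊆ V) (hD : D.Countable) (hYD : Y ⊆ closure D) :
    ∃ (q : ℕ → H) (r : ℕ → ℝ), (∀ k, r k ≠ 0) ∧ (∀ k, 0 < r k → q k ∈ D) ∧
      (∀ k, closedBall (q k) (r k) ⊆ O) ∧
      (∀ x ∈ V, ∃ t ∈ 𝓝 x, {k | (closedBall (q k) (r k) ∩ t).Nonempty}.Finite) ∧
      (Y ⊆ ⋃ k, ball (q k) (r k)) ∧ ∀ j k, 0 < r j → q j ∉ sphere (q k) (r k) := by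
  classical
  -- Radii outside this countable set of distances keep every centre off every sphere.
  have hbad : (Set.image2 dist D D).Countable := hD.image2 hD dist
  have : LocallyCompactSpace V := hV.locallyCompactSpace
  have : SigmaCompactSpace V := sigmaCompactSpace_of_locallyCompact_secondCountable
  obtain ⟨α, c, b, hp, hcov, hfin⟩ :=
    refinement_of_locallyCompact_sigmaCompact_of_nhds_basis_set (ι := fun _ : V ↦ H × ℝ)
      (p := fun x b ↦ (x : H) ∈ ball b.1 b.2 ∧ b.1 ∈ D ∧ b.2 ∉ Set.image2 dist D D ∧
        closedBall b.1 b.2 ⊆ O)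
      (B := fun _ b ↦ (↑) ⁻¹' ball b.1 b.2) hYV (by
        intro x hx
        refine ⟨fun U ↦ ⟨fun hU ↦ ?_, ?_⟩⟩
        · obtain ⟨U', hU', hUU⟩ := mem_nhds_subtype _ _ _ |>.1 hU
          obtain ⟨δ, hδ, hball⟩ := nhds_basis_closedBall.mem_iff.1
            (inter_mem hU' (hO.mem_nhds (hYO hx)))
          obtain ⟨q, hqD, hq⟩ := Metric.mem_closure_iff.1 (hYD hx) (δ / 4) (by positivity)
          obtain ⟨r, hr, hr1, hr2⟩ := (hbad.dense_compl ℝ).exists_between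
            (show δ / 4 < δ / 2 by linarith)
          have hsub : closedBall q r ⊆ closedBall (x : H) δ :=
            closedBall_subset_closedBall' (by rw [dist_comm] at hq; linarith)
          exact ⟨(q, r), ⟨mem_ball.2 (hq.trans hr1), hqD, hr, fun y hy ↦ (hball (hsub hy)).2⟩,
            fun y hy ↦ hUU (hball (hsub (ball_subset_closedBall hy))).1⟩
        · rintro ⟨b, hb, hbU⟩
          exact mem_of_superset
            ((isOpen_ball.preimage continuous_subtype_val).mem_nhds hb.1) hbU)
  have hpos (a : α) : 0 < (b a).2 := pos_of_mem_ball (hp a).2.1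
  have : Countable α := Set.countable_univ_iff.1
    (hfin.countable_univ fun a ↦ ⟨c a, (hp a).2.1⟩)
  obtain ⟨e, he⟩ := Countable.exists_injective_nat α
  let β : ℕ → H × ℝ := Function.extend e b fun _ ↦ (0, -1)
  have hβ (a : α) : β (e a) = b a := he.extend_apply _ _ _
  have hβ' (k : ℕ) (hk : ¬ ∃ a, e a = k) : β k = (0, -1) := Function.extend_apply' _ _ _ hk
  have hβpos (k : ℕ) (hk : 0 < (β k).2) : ∃ a, e a = k := by
    by_contra h
    rw [hβ' k h] at hk
    norm_num at hk
  refine ⟨fun k ↦ (β k).1, fun k ↦ (β k).2, fun k ↦ ?_, fun k hk ↦ ?_, fun k ↦ ?_, fun x hx ↦ ?_,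
    fun x hx ↦ ?_, fun j k hj hjk ↦ ?_⟩
  · by_cases hk : ∃ a, e a = k
    · obtain ⟨a, rfl⟩ := hk
      simpa only [hβ] using (hpos a).ne'
    · simp [hβ' k hk]
  · obtain ⟨a, rfl⟩ := hβpos k hk
    simpa only [hβ] using (hp a).2.2.1
  · by_cases hk : ∃ a, e a = k
    · obtain ⟨a, rfl⟩ := hk
      simpa only [hβ] using (hp a).2.2.2.2
    · simp [hβ' k hk]
  · obtain ⟨t, ht, hfin⟩ := hfin ⟨x, hx⟩
    obtain ⟨u, hut, huo, hxu⟩ :=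
      _root_.mem_nhds_iff.1 (hV.isOpenEmbedding_subtypeVal.image_mem_nhds.2 ht)
    refine ⟨u, huo.mem_nhds hxu, (hfin.image e).subset ?_⟩
    rintro k ⟨y, hy, hyu⟩
    have hk : ∃ a, e a = k := by
      by_contra h
      simp [hβ' k h] at hy
    obtain ⟨a, rfl⟩ := hk
    simp only [hβ] at hy
    -- An open set meeting a closed ball meets the open ball, so local finiteness passes to closed
    -- balls.
    rw [← closure_ball _ (hpos a).ne'] at hy
    obtain ⟨z, hzu, hz⟩ := mem_closure_iff.1 hy u huo hyu
    obtain ⟨w, hw, rfl⟩ := hut hzu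
    exact ⟨a, ⟨w, hz, hw⟩, rfl⟩
  · obtain ⟨a, ha⟩ := Set.mem_iUnion.1 (hcov (show (⟨x, hY hx⟩ : V) ∈ _ from hx))
    refine Set.mem_iUnion.2 ⟨e a, ?_⟩
    simp only [hβ]
    exact ha
  · obtain ⟨a, rfl⟩ := hβpos j hj
    have hk : ∃ a, e a = k := by
      by_contra h
      simp [hβ' k h] at hjk
    obtain ⟨a', rfl⟩ := hk
    simp only [hβ, mem_sphere] at hjk
    exact (hp a').2.2.2.1 ⟨_, (hp a).2.2.1, _, (hp a').2.2.1, hjk⟩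

end BallCover

/-! ### Zero-free approximation -/

section ZeroFreeApproximation

open MeasureTheory
open scoped ContDiff

variable {H : Type*} [NormedAddCommGroup H] [NormedSpace ℝ H] [FiniteDimensional ℝ H]

/-- Near each `x ∈ E` the constant `f x` is a valid local selection, since the constraint binds only
on `E`. -/
theorem exists_continuousOn_open_approx {E : Set H} {f : H → H} (hf : ContinuousOn f E)
    {ε : ℝ} (hε : 0 < ε) :
    ∃ (V : Set H) (F : H → H), IsOpen V ∧ E ⊆ V ∧ ContinuousOn F V ∧
      ∀ x ∈ E, ‖F x - f x‖ < ε := by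
  have h : ∀ x ∈ E, ∃ U, IsOpen U ∧ x ∈ U ∧ ∀ y ∈ U ∩ E, ‖f x - f y‖ < ε := by
    intro x hx
    have := hf x hx (ball_mem_nhds (f x) hε)
    obtain ⟨U, hUo, hxU, hU⟩ := mem_nhdsWithin.1 this
    exact ⟨U, hUo, hxU, fun y hy ↦ by simpa [dist_eq_norm, norm_sub_rev] using hU hy⟩
  choose! U hUo hxU hU using h
  have hVo : IsOpen (⋃ x ∈ E, U x) := isOpen_biUnion hUo
  obtain ⟨F, hF, hFt⟩ := hVo.exists_contDiffOn_forall_mem_convex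
    (t := fun y ↦ {c | y ∈ E → c ∈ ball (f y) ε})
    (fun y _ ↦ (convex_ball (f y) ε).setOf_imp _)
    (fun y hy ↦ by
      obtain ⟨x, hxE, hyx⟩ := Set.mem_iUnion₂.1 hy
      refine ⟨f x, ?_⟩
      filter_upwards [(hUo x hxE).mem_nhds hyx] with z hz _ hzE
      simpa [dist_eq_norm] using hU x hxE z ⟨hz, hzE⟩)
  have hEV : E ⊆ ⋃ x ∈ E, U x := fun x hx ↦ Set.mem_iUnion₂.2 ⟨x, hx, hxU x hx⟩
  exact ⟨_, F, hVo, hEV, hF.continuousOn, fun x hx ↦ by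
    simpa [dist_eq_norm] using hFt x (hEV hx) hx⟩

/-- A smooth map that has no zeros off an open set `Ω` can be perturbed, creating no zeros off
`Ω`, so that it does not vanish on countably many given null sets. -/
theorem exists_perturbation_ne_zero_on_null {V Ω : Set H} (hV : IsOpen V) (hΩ : IsOpen Ω)
    {G : H → H} (hG : ContDiffOn ℝ ∞ G V) (h0 : ∀ x ∈ V, x ∉ Ω → G x ≠ 0) [MeasurableSpace H]
    [BorelSpace H] (μ : Measure H) [μ.IsAddHaarMeasure] {S : ℕ → Set H} (hS : ∀ k, μ (S k) = 0)
    (hSV : ∀ k, S k ⊆ V) {ε : ℝ} (hε : 0 < ε) :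
    ∃ G' : H → H, ContinuousOn G' V ∧ (∀ x ∈ V, ‖G' x - G x‖ < ε) ∧
      (∀ x ∈ V, x ∉ Ω → G' x ≠ 0) ∧ ∀ k, ∀ x ∈ S k, G' x ≠ 0 := by
  obtain ⟨ρ, hρ, hρt⟩ := hV.exists_contDiffOn_forall_mem_convex
    (t := fun x ↦ {c : ℝ | c ∈ Set.Ioo 0 ε ∧ (x ∉ Ω → c < ‖G x‖)})
    (fun x _ ↦ (convex_Ioo 0 ε).inter ((convex_Iio ‖G x‖).setOf_imp _))
    (fun x hx ↦ by
      by_cases hxΩ : x ∈ Ω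
      · refine ⟨ε / 2, ?_⟩
        filter_upwards [hΩ.mem_nhds hxΩ] with y hy _
        exact ⟨⟨by linarith, by linarith⟩, fun h ↦ absurd hy h⟩
      · have hpos : 0 < ‖G x‖ := norm_pos_iff.2 (h0 x hx hxΩ)
        have hc : ContinuousAt (fun y ↦ ‖G y‖) x :=
          (hG.continuousOn.continuousAt (hV.mem_nhds hx)).norm
        refine ⟨min (ε / 2) (‖G x‖ / 2), ?_⟩
        filter_upwards [hc.eventually (lt_mem_nhds (half_lt_self hpos))] with y hy _
        exact ⟨⟨by positivity, (min_le_left _ _).trans_lt (by linarith)⟩,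
          fun _ ↦ (min_le_right _ _).trans_lt hy⟩)
  have hdiff : DifferentiableOn ℝ (fun x ↦ (ρ x)⁻¹ • G x) V :=
    ((hρ.differentiableOn (by simp)).inv fun x hx ↦ (hρt x hx).1.1.ne').smul
      (hG.differentiableOn (by simp))
  have hnull : μ (⋃ k, (fun x ↦ (ρ x)⁻¹ • G x) '' S k) = 0 :=
    measure_iUnion_null fun k ↦
      addHaar_image_eq_zero_of_differentiableOn_of_addHaar_eq_zero μ (hdiff.mono (hSV k)) (hS k)
  -- If `c` is not a value of `G / ρ` on the spheres, then `G - ρ • c` has no zero there.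
  obtain ⟨c, hc1, hc⟩ : ∃ c ∈ ball (0 : H) 1, c ∉ ⋃ k, (fun x ↦ (ρ x)⁻¹ • G x) '' S k := by
    by_contra! h
    exact (measure_ball_pos μ (0 : H) one_pos).ne' (measure_mono_null h hnull)
  rw [mem_ball_zero_iff] at hc1
  have hlt : ∀ x ∈ V, ‖ρ x • c‖ < ε ∧ (x ∉ Ω → ‖ρ x • c‖ < ‖G x‖) := by
    intro x hx
    obtain ⟨⟨h1, h2⟩, h3⟩ := hρt x hx
    have h4 : ‖ρ x • c‖ ≤ ρ x := by
      rw [norm_smul, Real.norm_of_nonneg h1.le]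
      exact mul_le_of_le_one_right h1.le hc1.le
    exact ⟨h4.trans_lt h2, fun h ↦ h4.trans_lt (h3 h)⟩
  refine ⟨fun x ↦ G x - ρ x • c, ?_, fun x hx ↦ ?_, fun x hx hxΩ h ↦ ?_, fun k x hx h ↦ ?_⟩
  · exact hG.continuousOn.sub (hρ.continuousOn.smul continuousOn_const)
  · simpa using (hlt x hx).1
  · have := (hlt x hx).2 hxΩ
    rw [← sub_eq_zero.1 h] at this
    exact this.false
  · refine hc (Set.mem_iUnion.2 ⟨k, x, hx, ?_⟩)
    have h1 : ρ x ≠ 0 := (hρt x (hSV k hx)).1.1.ne'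
    simp only [sub_eq_zero.1 h, smul_smul, inv_mul_cancel₀ h1, one_smul]

/-- A continuous approximation of `f` is approximated by a smooth map, zero-free off any open set
`Ω` that contains the small values outside the interior of the domain of `f`. -/
theorem exists_contDiffOn_approx_ne_zero {E V Ω : Set H} {f F : H → H} {ε : ℝ}
    (hf : ContinuousOn f E) (hf0 : ∀ x ∈ interior E, f x ≠ 0) (hV : IsOpen V) (hΩ : IsOpen Ω)
    (hF : ContinuousOn F V) (hFf : ∀ x ∈ E, ‖F x - f x‖ < ε) (hε : 0 < ε)
    (hY : ∀ x ∈ V, x ∉ interior E → ‖F x‖ ≤ 4 * ε → x ∈ Ω) :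
    ∃ G : H → H, ContDiffOn ℝ ∞ G V ∧ (∀ x ∈ V, ‖G x - F x‖ < ε) ∧
      ∀ x ∈ V, x ∉ Ω → G x ≠ 0 := by
  obtain ⟨G, hG, hGt⟩ := hV.exists_contDiffOn_forall_mem_convex
    -- The ball of radius `‖f x‖` about `f x` is a convex set that excludes `0`.
    (t := fun x ↦ {c | c ∈ ball (F x) ε ∧ (x ∈ interior E ∧ x ∉ Ω → c ∈ ball (f x) ‖f x‖)})
    (fun x _ ↦ (convex_ball _ _).inter ((convex_ball _ _).setOf_imp _))
    (fun x hx ↦ by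
      have hFx : ContinuousAt F x := hF.continuousAt (hV.mem_nhds hx)
      by_cases hxE : x ∈ interior E
      · have hfx : ContinuousAt f x := hf.continuousAt (mem_interior_iff_mem_nhds.1 hxE)
        have h1 : ∀ᶠ y in 𝓝 x, dist (f x) (F y) < ε :=
          (continuousAt_const.dist hFx).eventually (gt_mem_nhds (by
            rw [dist_comm, dist_eq_norm]; exact hFf x (interior_subset hxE)))
        have h2 : ∀ᶠ y in 𝓝 x, dist (f x) (f y) < ‖f y‖ :=
          (continuousAt_const.dist hfx).eventually_lt hfx.norm (by simpa using hf0 x hxE)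
        refine ⟨f x, ?_⟩
        filter_upwards [h1, h2] with y h1 h2 _
        exact ⟨h1, fun _ ↦ h2⟩
      · refine ⟨F x, ?_⟩
        have h1 : ∀ᶠ y in 𝓝 x, dist (F x) (F y) < ε :=
          (continuousAt_const.dist hFx).eventually (gt_mem_nhds (by simpa using hε))
        by_cases hxΩ : x ∈ Ω
        · filter_upwards [h1, hΩ.mem_nhds hxΩ] with y h1 hy _
          exact ⟨h1, fun h ↦ absurd hy h.2⟩
        -- Here `F x` is within `2 * ε` of `f y`, while `‖f y‖` exceeds `2 * ε`.
        · have h4 : 4 * ε < ‖F x‖ := not_le.1 fun h ↦ hxΩ (hY x hx hxE h)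
          filter_upwards [h1] with y h1 _
          refine ⟨h1, fun h ↦ ?_⟩
          have h2 := hFf y (interior_subset h.1)
          rw [← dist_eq_norm] at h2
          have h3 := dist_triangle (F x) (F y) (f y)
          have h5 := norm_le_norm_add_norm_sub' (F x) (f y)
          rw [← dist_eq_norm] at h5
          rw [mem_ball]
          linarith)
  refine ⟨G, hG, fun x hx ↦ ?_, fun x hx hxΩ h ↦ ?_⟩
  · simpa [dist_eq_norm] using (hGt x hx).1
  · obtain ⟨h1, h2⟩ := hGt x hx
    by_cases hxE : x ∈ interior E
    · simpa [h] using h2 ⟨hxE, hxΩ⟩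
    · have h4 : 4 * ε < ‖F x‖ := not_le.1 fun h ↦ hxΩ (hY x hx hxE h)
      rw [h, mem_ball, dist_zero_left] at h1
      linarith

theorem exists_zeroFree_approx {E : Set H} {f : H → H} (hf : ContinuousOn f E)
    (hf0 : ∀ x ∈ interior E, f x ≠ 0) {ε : ℝ} (hε : 0 < ε) :
    ∃ g : H → H, ContinuousOn g E ∧ ∀ x ∈ E, g x ≠ 0 ∧ ‖g x - f x‖ ≤ 13 * ε := by
  borelize H
  let μ : Measure H := Measure.addHaar
  obtain ⟨V, F, hV, hEV, hF, hFf⟩ := exists_continuousOn_open_approx hf hε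
  obtain ⟨D, hDE, hD, hDd⟩ :=
    (TopologicalSpace.IsSeparable.of_separableSpace Eᶜ).exists_countable_dense_subset
  have hO : IsOpen (V ∩ {x | ‖F x‖ < 5 * ε}) :=
    hF.norm.isOpen_inter_preimage hV (isOpen_Iio (a := 5 * ε))
  obtain ⟨q, r, hr0, hqD, hqO, hfin, hcov, hq⟩ :=
    exists_locallyFinite_ball_cover (Y := {x | x ∈ V ∧ x ∉ interior E ∧ ‖F x‖ ≤ 4 * ε})
      hV hO (fun x hx ↦ ⟨hx.1, hx.2.2.trans_lt (by linarith)⟩)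
      (by
        have h1 : IsClosed {x : V | (x : H) ∉ interior E} :=
          (isOpen_interior.preimage continuous_subtype_val).isClosed_compl
        have h2 : IsClosed {x : V | ‖F x‖ ≤ 4 * ε} :=
          isClosed_le hF.domRestrict.norm continuous_const
        convert h1.inter h2 using 1
        ext x
        simp)
      (fun x hx ↦ hx.1) hD
      (fun x hx ↦ by
        have : x ∈ closure Eᶜ := by rw [closure_compl]; exact hx.2.1
        exact closure_minimal hDd isClosed_closure this)
  set Ω := ⋃ k, ball (q k) (r k) with hΩ
  have hΩo : IsOpen Ω := isOpen_iUnion fun k ↦ isOpen_ball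
  obtain ⟨G₁, hG₁, hG₁F, hG₁0⟩ := exists_contDiffOn_approx_ne_zero hf hf0 hV hΩo hF hFf hε
    (fun x hx h1 h2 ↦ hcov ⟨hx, h1, h2⟩)
  obtain ⟨G, hG, hGG₁, hG0, hGS⟩ := exists_perturbation_ne_zero_on_null hV hΩo hG₁ hG₁0 μ
    (S := fun k ↦ sphere (q k) (r k)) (fun k ↦ Measure.addHaar_sphere_of_ne_zero μ _ (hr0 k))
    (fun k x hx ↦ (hqO k (sphere_subset_closedBall hx)).1) hε
  have hGF : ∀ x ∈ V, ‖G x - F x‖ < 2 * ε := by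
    intro x hx
    have := norm_sub_le_norm_sub_add_norm_sub (G x) (G₁ x) (F x)
    linarith [hGG₁ x hx, hG₁F x hx]
  -- On the balls `‖G‖ < (5 + 2) * ε` and, within `E`, `‖f‖ < (5 + 1) * ε`; hence the final 13.
  obtain ⟨g, hg, hg0⟩ := exists_zeroFree_off_centers hG (M := 7 * ε)
    (fun k x hx ↦ (hqO k hx).1) hfin hGS hq
    (fun k x hx ↦ by
      have h1 := hGF x (hqO k hx).1
      have h2 : ‖F x‖ < 5 * ε := (hqO k hx).2
      linarith [norm_le_norm_add_norm_sub' (G x) (F x)])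
    (fun x hx h ↦ by
      by_contra! h'
      refine hG0 x hx (fun hxΩ ↦ ?_) h
      obtain ⟨k, hk⟩ := Set.mem_iUnion.1 hxΩ
      exact h' k (ball_subset_closedBall hk))
  have hsub : E ⊆ V \ {x | ∃ k, 0 < r k ∧ x = q k} := by
    refine fun x hx ↦ ⟨hEV hx, ?_⟩
    rintro ⟨k, hk, rfl⟩
    exact hDE (hqD k hk) hx
  refine ⟨g, hg.mono hsub, fun x hx ↦ ?_⟩
  obtain ⟨h0, h⟩ := hg0 x (hsub hx)
  refine ⟨h0, ?_⟩
  rcases h with h | ⟨⟨k, hk⟩, h⟩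
  · rw [h]
    have := norm_sub_le_norm_sub_add_norm_sub (G x) (F x) (f x)
    linarith [hGF x (hEV hx), hFf x hx]
  · have h2 : ‖F x‖ < 5 * ε := (hqO k hk).2
    have h3 := norm_le_norm_add_norm_sub (F x) (f x)
    linarith [norm_sub_le (g x) (f x), hFf x hx]

end ZeroFreeApproximation

theorem theorem1 (n : ℕ) (E : Set (EuclideanSpace ℝ (Fin n)))
    (f : E → EuclideanSpace ℝ (Fin n)) (hf : Continuous f)
    (hf0 : ∀ x : E, (x : EuclideanSpace ℝ (Fin n)) ∈ interior E → f x ≠ 0) :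
    ∃ g : ℕ → E → EuclideanSpace ℝ (Fin n),
      (∀ k, Continuous (g k)) ∧ (∀ k, ∀ x : E, g k x ≠ 0) ∧
        TendstoUniformly g f Filter.atTop := by
  classical
  let f' : EuclideanSpace ℝ (Fin n) → EuclideanSpace ℝ (Fin n) :=
    fun x ↦ if h : x ∈ E then f ⟨x, h⟩ else 0
  have hf'eq (x : E) : f' x = f x := dif_pos x.2
  have hf' : ContinuousOn f' E := by
    rw [continuousOn_iff_continuous_domRestrict]
    convert hf using 1
    exact funext hf'eq
  have hf0' : ∀ x ∈ interior E, f' x ≠ 0 := fun x hx ↦ by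
    rw [hf'eq ⟨x, interior_subset hx⟩]
    exact hf0 _ hx
  choose g hg hg0 using fun k : ℕ ↦
    exists_zeroFree_approx hf' hf0' (Nat.one_div_pos_of_nat (α := ℝ) (n := k))
  refine ⟨fun k ↦ E.domRestrict (g k), fun k ↦ (hg k).domRestrict, fun k x ↦ (hg0 k x x.2).1, ?_⟩
  rw [Metric.tendstoUniformly_iff]
  intro ε hε
  have hlim : Tendsto (fun k : ℕ ↦ 13 * (1 / ((k : ℝ) + 1))) atTop (𝓝 0) := by
    simpa using tendsto_one_div_add_atTop_nhds_zero_nat.const_mul (13 : ℝ)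
  filter_upwards [hlim.eventually (gt_mem_nhds hε)] with k hk x
  rw [dist_comm, dist_eq_norm, ← hf'eq]
  exact (hg0 k x x.2).2.trans_lt hk
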